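/- **Lemma (the chain $\widehat Q$ and renewal probabilities of a RAM-biased permutation).** Let $W_1,W_2,\ldots$ be i.i.d. copies of a random variable $W$ with values in $(0,1)$, let $P_i:=(1-W_1)\cdots(1-W_{i-1})W_i$ $(i\ge 1)$ be the random discrete distribution on $\mathbb N_+=\{1,2,\ldots\}$ of the corresponding residual allocation model (RAM), and let $X_1,X_2,\ldots$ be a sample from it: given $P=(P_1,P_2,\ldots)$, the $X_i$ are i.i.d. with distribution $P$ ($X_i$ is the box hit by ball $i$). Let $$Q^*_n(k):=\sum_{i=1}^n 1(X_i>k)$$ be the number of the first $n$ balls landing outside the first $k$ boxes $(k\ge 0)$, and for $m\ge 1$ let $n(k,m):=\min\{n: Q^*_n(k)=m\}$, which is almost surely well defined. Let $\Pi$ be the $P$-biased permutation of $\mathbb N_+$ obtained by listing the distinct values of $X_1,X_2,\ldots$ in order of appearance, and let $u_k:=\mathbb P(\Pi \text{ maps } \{1,\ldots,k\} \text{ onto itself})$ be its renewal probabilities. Put $$\widehat q(m,n):=\binom{n-1}{m-1}\,\mathbb E\big[W^{n-m}(1-W)^m\big]\quad (1\le m\le n),\qquad \widehat q(m,n):=0\quad(n<m).$$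 Then $\widehat q$ is a transition probability function on $\mathbb N_+$, so that Markov chains $\widehat Q=(\widehat Q_0,\widehat Q_1,\ldots)$ with stationary transition function $\widehat q$ exist for every initial distribution; they satisfy $1\le\widehat Q_0\le\widehat Q_1\le\cdots$ almost surely. Moreover: 1. For each $k\ge 0$ and $m\ge 1$ there is the equality of joint distributions $$\big(Q^*_{n(k,m)}(k-j),\ 0\le j\le k\big)\overset{(d)}{=}\big(\widehat Q_j,\ 0\le j\le k \,\big|\, \widehat Q_0=m\big).$$ The distribution $\widehat q(m,\cdot)$ is the mixture of the Pascal$(m,1-W)$ distributions, and the distribution of the increment of $\widehat Q$ from state $m$ is mixed negative binomial $(m,1-W)$. Here Pascal$(m,p)$, respectively negative binomial$(m,p)$, is the law of the sum of $m$ independent geometric variables with success probability $p$ on $\{1,2,\ldots\}$, respectively on $\{0,1,2,\ldots\}$. 2. For each $k\ge 1$, $$u_k=\mathbb P\big(\widehat Q_0<\widehat Q_1<\cdots<\widehat Q_k \,\big|\, \widehat Q_0=1\big).$$ 3. The sequence $(u_k)_{k\ge 1}$ is strictly decreasing, and its limit $u_\infty:=\lim_{k\to\infty}u_k\ge 0$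 exists and equals $$u_\infty=\mathbb P\big(\widehat Q_0<\widehat Q_1<\cdots \,\big|\, \widehat Q_0=1\big).$$ -/

import Mathlib

open MeasureTheory ProbabilityTheory Filter Topology

noncomputable section

namespace ResidualAllocation

/-- Every set of positive integers is measurable. -/
instance instMeasurableSpacePNat : MeasurableSpace ℕ+ := ⊤

instance instDiscreteMeasurableSpacePNat : DiscreteMeasurableSpace ℕ+ := ⟨fun _ => trivial⟩

variable {Ω : Type*} [MeasurableSpace Ω]

/-- `W 1, W 2, …` are i.i.d. random variables with common distribution `ν`,
a probability distribution on the open interval `(0,1)`. -/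
structure IsStickBreaking (ν : Measure unitInterval) (W : ℕ+ → Ω → unitInterval)
    (μ : Measure Ω) : Prop where
  measurable : ∀ i, Measurable (W i)
  indep : iIndepFun W μ
  law : ∀ i, μ.map (W i) = ν
  mem_Ioo : ∀ᵐ w ∂ν, 0 < w ∧ w < 1

/-- The random discrete distribution of the residual allocation model,
`P i = (1 - W 1) ⋯ (1 - W (i-1)) * W i`. -/
def ramWeight (W : ℕ+ → Ω → unitInterval) (i : ℕ+) (ω : Ω) : ℝ :=
  (∏ j ∈ Finset.Iio i, (1 - (W j ω : ℝ))) * (W i ω : ℝ)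

/-- `X 0, X 1, …` (the boxes hit by the first, second, … ball) is a sample from the random
discrete distribution `P`: conditionally given `P`, the `X i` are independent, each with
distribution `P` on the positive integers. -/
structure IsSampleFrom (P : ℕ+ → Ω → ℝ) (X : ℕ → Ω → ℕ+) (μ : Measure Ω) : Prop where
  measurable : ∀ i, Measurable (X i)
  cond_law : ∀ (n : ℕ) (x : ℕ → ℕ+),
    μ⟦{ω | ∀ i < n, X i ω = x i} |
        MeasurableSpace.comap (fun ω (i : ℕ+) => P i ω) inferInstance⟧
      =ᵐ[μ] fun ω => ∏ i ∈ Finset.range n, P (x i) ω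

/-- `Q*_n(k)`: the number of the first `n` balls that land outside the first `k` boxes. -/
def outsideCount (X : ℕ → Ω → ℕ+) (n k : ℕ) (ω : Ω) : ℕ :=
  ∑ i ∈ Finset.range n, if k < (X i ω : ℕ) then 1 else 0

/-- `n(k,m)`: the least `n` such that `m` of the first `n` balls are outside the first
`k` boxes. -/
def hitTime (X : ℕ → Ω → ℕ+) (k m : ℕ) (ω : Ω) : ℕ :=
  sInf {n : ℕ | outsideCount X n k ω = m}

/-- The permutation listing the distinct values of the sequence `x` in order of appearance:
its `i`-th value is `x j`, where `j` is the `i`-th index at which a value occurs that did not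
occur before. -/
def appearance (x : ℕ → ℕ+) (i : ℕ+) : ℕ+ :=
  x (Nat.nth (fun j => ∀ l < j, x l ≠ x j) i.natPred)

/-- `{1, …, k}` is a block of `π`: it is permuted by `π`. -/
def IsInitialBlock (π : ℕ+ → ℕ+) (k : ℕ) : Prop :=
  Set.BijOn π {i : ℕ+ | (i : ℕ) ≤ k} {i : ℕ+ | (i : ℕ) ≤ k}

/-- The renewal probability `u k` of the `P`-biased permutation given by a sample `X` from `P`:
the probability that `{1, …, k}` is a block of the permutation. -/
def renewalProb (μ : Measure Ω) (X : ℕ → Ω → ℕ+) (k : ℕ) : ℝ :=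
  μ.real {ω | IsInitialBlock (appearance fun i => X i ω) k}

/-- The transition probability function
`qHat m n = C(n-1, m-1) * E[W^(n-m) * (1-W)^m]` for `m ≤ n` (and `0` otherwise),
where `W` has distribution `ν`. -/
def qHat (ν : Measure unitInterval) (m n : ℕ+) : ℝ :=
  if m ≤ n then
    (((n : ℕ) - 1).choose ((m : ℕ) - 1) : ℝ) *
      ∫ w, (w : ℝ) ^ ((n : ℕ) - (m : ℕ)) * (1 - (w : ℝ)) ^ (m : ℕ) ∂ν
  else 0

/-- `Q 0, Q 1, …` is a Markov chain on the positive integers with stationary transition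
probability function `q` (and arbitrary initial distribution). -/
structure IsMarkovChain (q : ℕ+ → ℕ+ → ℝ) (Q : ℕ → Ω → ℕ+) (μ : Measure Ω) : Prop where
  measurable : ∀ j, Measurable (Q j)
  step : ∀ (n : ℕ) (x : ℕ → ℕ+),
    μ.real {ω | ∀ i ≤ n + 1, Q i ω = x i} =
      μ.real {ω | ∀ i ≤ n, Q i ω = x i} * q (x n) (x (n + 1))

/-- The negative binomial `(m, p)` distribution: the number of failures before the `m`-th
success, a sum of `m` independent geometric `(p)` variables on `{0, 1, …}`. -/
def negBinomial (m : ℕ) (p : unitInterval) : Measure ℕ :=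
  (Measure.pi fun _ : Fin m => geometricMeasure p).map fun g => ∑ i, g i

/-- The Pascal `(m, p)` distribution: the number of trials until the `m`-th success, a sum of
`m` independent geometric `(p)` variables on `{1, 2, …}`. -/
def pascal (m : ℕ) (p : unitInterval) : Measure ℕ :=
  (Measure.pi fun _ : Fin m => geometricMeasure p).map fun g => ∑ i, (g i + 1)

end ResidualAllocation

end

open ResidualAllocation

/-!
Write `w j` for the factor of box `j + 1`. Given the factors, the balls are independent, and a ball
that is outside the first `j` boxes lies in box `j + 1` with probability `w j`. Hence the numbers of
balls outside the first `0, 1, …, k` boxes arise by successive binomial thinning of the `n` balls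
(`pi_boxMeasure_countGt`, by induction on `n`, with Pascal's rule in the form `thinProd_eq_sum`).
Requiring the last ball to be outside the first `k` boxes turns each binomial weight
`C(N, M) w^(N-M) (1-w)^M` into the Pascal weight `C(N-1, M-1) w^(N-M) (1-w)^M`
(`pi_boxMeasure_countGt_last`), and since the factors are independent, averaging over them gives
a product of values of `qHat` (`measure_counts`). Read from box `k` backwards, this product is the
probability of a path of the chain.

So every path of the chain started at `m` has the probability of an event on which it coincides with
the sequence of reversed counts: the law of the chain is dominated by the law of the reversed counts.
Both are probability measures, hence they are equal (`identDistrib_reversedCounts`). That the times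
`n(k, m)` are almost surely well defined is a consequence of this equality, not a preliminary to it
(`ae_exists_outsideCount_eq`).

For the permutation, let ball `T` be the first one outside the first `k` boxes. These boxes form
a block exactly when all of them are hit before time `T` (`isInitialBlock_appearance_iff`), that is,
when the reversed counts with `m = 1` are strictly increasing. This identifies the renewal
probabilities with `P(Q 0 < ⋯ < Q k)` (`renewalProb_eq`). They decrease strictly, because the path
`1, 2, …, k + 1, k + 1` has positive probability, and their limit is given by continuity from above.

A chain with transition function `qHat` and any initial law is obtained from independent choices, for
every time and every state, of the next state (`exists_isMarkovChain`).
-/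

namespace ResidualAllocation

open scoped ENNReal

/-! ### Negative binomial and Pascal distributions -/

theorem card_piAntidiag_univ_fin (m d : ℕ) :
    (Finset.piAntidiag (Finset.univ : Finset (Fin m)) d).card = m.multichoose d := by
  rw [← Finset.map_sym_eq_piAntidiag, Finset.card_map, Finset.sym_univ, Finset.card_univ,
    Sym.card_sym_fin_eq_multichoose]

theorem negBinomial_singleton (m d : ℕ) {p : unitInterval} (hp : p ≠ 0) :
    negBinomial m p {d} =
      ENNReal.ofReal (m.multichoose d * ((p : ℝ) ^ m * (1 - (p : ℝ)) ^ d)) := by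
  have hpre : (fun g : Fin m → ℕ => ∑ i, g i) ⁻¹' {d} =
      ↑(Finset.piAntidiag (Finset.univ : Finset (Fin m)) d) := by
    ext g; simp
  rw [negBinomial, Measure.map_apply (by fun_prop) (measurableSet_singleton d), hpre,
    ← sum_measure_singleton]
  have key : ∀ g ∈ Finset.piAntidiag (Finset.univ : Finset (Fin m)) d,
      (Measure.pi fun _ : Fin m => geometricMeasure p) {g} =
        ENNReal.ofReal ((p : ℝ) ^ m * (1 - (p : ℝ)) ^ d) := by
    intro g hg
    rw [← Set.univ_pi_singleton, Measure.pi_pi]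
    simp only [geometricMeasure_singleton hp]
    rw [← ENNReal.ofReal_prod_of_nonneg fun i _ => geometricMeasure_nonneg p _,
      Finset.prod_mul_distrib, Finset.prod_pow_eq_pow_sum, (Finset.mem_piAntidiag.1 hg).1]
    simp [mul_comm]
  rw [Finset.sum_congr rfl key, Finset.sum_const, card_piAntidiag_univ_fin, nsmul_eq_mul,
    ENNReal.ofReal_mul (p := (m.multichoose d : ℝ)) (by positivity), ENNReal.ofReal_natCast]

theorem pascal_apply_add (m d : ℕ) (p : unitInterval) :
    pascal m p {m + d} = negBinomial m p {d} := by
  rw [negBinomial, pascal, Measure.map_apply (by fun_prop) (measurableSet_singleton _),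
    Measure.map_apply (by fun_prop) (measurableSet_singleton _)]
  congr 1
  ext g
  simp [Finset.sum_add_distrib]
  omega

theorem pascal_apply_of_lt {m n : ℕ} (h : n < m) (p : unitInterval) : pascal m p {n} = 0 := by
  rw [pascal, Measure.map_apply (by fun_prop) (measurableSet_singleton _)]
  have : (fun g : Fin m → ℕ => ∑ i, (g i + 1)) ⁻¹' {n} = ∅ := by
    ext g
    simp [Finset.sum_add_distrib]
    omega
  rw [this, measure_empty]

instance isProbabilityMeasure_pascal (m : ℕ) (p : unitInterval) :
    IsProbabilityMeasure (pascal m p) :=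
  Measure.isProbabilityMeasure_map (Measurable.aemeasurable (by fun_prop))

/-! ### The transition function `qHat` -/

section qHat

variable {ν : Measure unitInterval}

/-- The integrand of `qHat`, with its combinatorial factor: the Pascal `(m, 1 - w)` probability
of `n`. -/
def qHatKernel (m n : ℕ+) (w : unitInterval) : ℝ :=
  if m ≤ n then
    (((n : ℕ) - 1).choose ((m : ℕ) - 1) : ℝ) *
      ((w : ℝ) ^ ((n : ℕ) - (m : ℕ)) * (1 - (w : ℝ)) ^ (m : ℕ))
  else 0

theorem qHatKernel_nonneg (m n : ℕ+) (w : unitInterval) : 0 ≤ qHatKernel m n w := by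
  unfold qHatKernel
  have := sub_nonneg.2 w.2.2
  have := w.2.1
  split_ifs <;> positivity

theorem continuous_qHatKernel (m n : ℕ+) : Continuous (qHatKernel m n) := by
  unfold qHatKernel
  split_ifs <;> fun_prop

theorem integrable_qHatKernel [IsFiniteMeasure ν] (m n : ℕ+) : Integrable (qHatKernel m n) ν := by
  obtain ⟨C, hC⟩ := isCompact_univ.exists_bound_of_continuousOn
    (continuous_qHatKernel m n).continuousOn
  exact Integrable.of_bound (continuous_qHatKernel m n).aestronglyMeasurable C
    (ae_of_all _ fun w => hC w trivial)

theorem qHat_eq_integral (m n : ℕ+) : qHat ν m n = ∫ w, qHatKernel m n w ∂ν := by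
  unfold qHat qHatKernel
  split_ifs
  · rw [integral_const_mul]
  · simp

theorem ofReal_qHat [IsFiniteMeasure ν] (m n : ℕ+) :
    ENNReal.ofReal (qHat ν m n) = ∫⁻ w, ENNReal.ofReal (qHatKernel m n w) ∂ν := by
  rw [qHat_eq_integral, ofReal_integral_eq_lintegral_ofReal (integrable_qHatKernel m n)
    (ae_of_all _ (qHatKernel_nonneg m n))]

theorem qHat_nonneg (m n : ℕ+) : 0 ≤ qHat ν m n := by
  rw [qHat_eq_integral]
  exact integral_nonneg (qHatKernel_nonneg m n)

theorem qHat_of_lt {m n : ℕ+} (h : n < m) : qHat ν m n = 0 := by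
  simp [qHat, not_le.2 h]

theorem qHat_pos [IsProbabilityMeasure ν] (hν : ∀ᵐ w ∂ν, 0 < w ∧ w < 1) {m n : ℕ+} (h : m ≤ n) :
    0 < qHat ν m n := by
  rw [qHat_eq_integral, integral_pos_iff_support_of_nonneg (qHatKernel_nonneg m n)
    (integrable_qHatKernel m n)]
  have hae : ∀ᵐ w ∂ν, w ∈ Function.support (qHatKernel m n) := by
    filter_upwards [hν] with w hw
    have h0 : (0 : ℝ) < w := hw.1
    have h1 : (0 : ℝ) < 1 - w := sub_pos.2 hw.2
    have hc : 0 < ((n : ℕ) - 1).choose ((m : ℕ) - 1) :=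
      Nat.choose_pos (Nat.sub_le_sub_right (by exact_mod_cast h) 1)
    rw [Function.mem_support, qHatKernel, if_pos h]
    positivity
  rw [show ν (Function.support (qHatKernel m n)) = ν Set.univ from
    measure_congr (eventuallyEq_univ.2 hae), measure_univ]
  exact one_pos

theorem pascal_symm_eq_qHatKernel (m n : ℕ+) {w : unitInterval} (hw : w < 1) :
    pascal m (unitInterval.symm w) {(n : ℕ)} = ENNReal.ofReal (qHatKernel m n w) := by
  have hp : unitInterval.symm w ≠ 0 := by
    intro h
    exact hw.ne (by simpa using congrArg unitInterval.symm h)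
  rcases le_or_gt m n with h | h
  · obtain ⟨d, hd⟩ := Nat.exists_eq_add_of_le (show (m : ℕ) ≤ n by exact_mod_cast h)
    have hm := m.pos
    rw [hd, pascal_apply_add, negBinomial_singleton _ _ hp, qHatKernel, if_pos h, hd,
      Nat.multichoose_eq, show (m : ℕ) + d - 1 = d + (m - 1) by omega, Nat.choose_symm_add]
    simp [mul_comm]
  · rw [pascal_apply_of_lt (by exact_mod_cast h), qHatKernel, if_neg (not_le.2 h),
      ENNReal.ofReal_zero]

theorem ofReal_qHat_eq_lintegral_pascal [IsFiniteMeasure ν] (hν : ∀ᵐ w ∂ν, 0 < w ∧ w < 1)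
    (m n : ℕ+) :
    ENNReal.ofReal (qHat ν m n) = ∫⁻ w, pascal m (unitInterval.symm w) {(n : ℕ)} ∂ν := by
  rw [ofReal_qHat]
  refine lintegral_congr_ae ?_
  filter_upwards [hν] with w hw
  rw [pascal_symm_eq_qHatKernel m n hw.2]

theorem tsum_pascal (m : ℕ+) (p : unitInterval) : ∑' n : ℕ+, pascal m p {(n : ℕ)} = 1 := by
  have h : ∑' n, pascal m p {n} = 1 := by
    simpa using Measure.tsum_indicator_apply_singleton (pascal m p) Set.univ .univ
  rw [tsum_eq_zero_add' ENNReal.summable, pascal_apply_of_lt m.pos, zero_add] at h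
  rw [tsum_pnat_eq_tsum_succ (f := fun n => pascal m p {n}), h]

theorem tsum_ofReal_qHat [IsProbabilityMeasure ν] (hν : ∀ᵐ w ∂ν, 0 < w ∧ w < 1) (m : ℕ+) :
    ∑' n, ENNReal.ofReal (qHat ν m n) = 1 := by
  simp_rw [ofReal_qHat]
  rw [← lintegral_tsum fun n => (continuous_qHatKernel m n).measurable.ennreal_ofReal.aemeasurable]
  trans ∫⁻ _, 1 ∂ν
  · refine lintegral_congr_ae ?_
    filter_upwards [hν] with w hw
    simp_rw [← pascal_symm_eq_qHatKernel m _ hw.2]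
    exact tsum_pascal m _
  · simp

theorem hasSum_qHat [IsProbabilityMeasure ν] (hν : ∀ᵐ w ∂ν, 0 < w ∧ w < 1) (m : ℕ+) :
    HasSum (fun n => qHat ν m n) 1 := by
  have h := ENNReal.hasSum_toReal (f := fun n => ENNReal.ofReal (qHat ν m n))
    (by rw [tsum_ofReal_qHat hν]; simp)
  rw [← ENNReal.tsum_toReal_eq (fun _ => ENNReal.ofReal_ne_top), tsum_ofReal_qHat hν] at h
  simpa [ENNReal.toReal_ofReal, qHat_nonneg] using h

end qHat

/-! ### Markov chains on the positive integers -/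

section MarkovChain

variable {q : ℕ+ → ℕ+ → ℝ}

/-- The path started at `s` whose step at time `n` from state `a` leads to `ξ (n, a)`. -/
def chainPath (s : ℕ+) (ξ : ℕ × ℕ+ → ℕ+) : ℕ → ℕ+
  | 0 => s
  | n + 1 => ξ (n, chainPath s ξ n)

theorem chainPath_eq_iff (s : ℕ+) (ξ : ℕ × ℕ+ → ℕ+) (n : ℕ) (x : ℕ → ℕ+) :
    (∀ i ≤ n, chainPath s ξ i = x i) ↔ s = x 0 ∧ ∀ i < n, ξ (i, x i) = x (i + 1) := by
  induction n with
  | zero => simp [chainPath]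
  | succ n ih =>
    constructor
    · intro h
      obtain ⟨h0, h1⟩ := ih.1 fun i hi => h i (by omega)
      refine ⟨h0, fun i hi => ?_⟩
      rw [← h i (by omega), ← h (i + 1) (by omega), chainPath]
    · rintro ⟨h0, h1⟩ i hi
      have h := ih.2 ⟨h0, fun i hi => h1 i (by omega)⟩
      rcases Nat.lt_succ_iff_lt_or_eq.1 (Nat.lt_succ_iff.2 hi) with hi | rfl
      · exact h i (by omega)
      · rw [chainPath, h n le_rfl, h1 n (by omega)]

theorem measurable_chainPath (n : ℕ) :
    Measurable fun p : ℕ+ × (ℕ × ℕ+ → ℕ+) => chainPath p.1 p.2 n := by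
  induction n with
  | zero => exact measurable_fst
  | succ n ih =>
    have h : Measurable fun p : ℕ+ × (ℕ × ℕ+ → ℕ+) => p.2 (n, p.1) :=
      measurable_from_prod_countable_right fun a => measurable_pi_apply (n, a)
    exact h.comp (ih.prodMk measurable_snd)

/-- The distribution on the positive integers with probabilities `q a b`, for a fixed `a`. -/
noncomputable def stepMeasure (q : ℕ+ → ℕ+ → ℝ) (a : ℕ+) : Measure ℕ+ :=
  Measure.sum fun b => ENNReal.ofReal (q a b) • Measure.dirac b

/-- A Markov chain with a given stochastic matrix is run by making independent choices, for every
time and every state, of the state to be visited next. -/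
theorem exists_isMarkovChain (h0 : ∀ a b, 0 ≤ q a b) (h1 : ∀ a, HasSum (q a) 1)
    (π : Measure ℕ+) [IsProbabilityMeasure π] :
    ∃ κ : Measure (ℕ → ℕ+), IsProbabilityMeasure κ ∧ IsMarkovChain q (fun j x => x j) κ ∧
      κ.map (fun x => x 0) = π := by
  have hprob : ∀ a, IsProbabilityMeasure (stepMeasure q a) := fun a =>
    (h1 a).isProbabilityMeasure_sum_dirac (h0 a)
  let P : Measure (ℕ+ × (ℕ × ℕ+ → ℕ+)) :=
    π.prod (Measure.infinitePi fun p : ℕ × ℕ+ => stepMeasure q p.2)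
  let F : ℕ+ × (ℕ × ℕ+ → ℕ+) → ℕ → ℕ+ := fun p => chainPath p.1 p.2
  have hF : Measurable F := measurable_pi_lambda _ measurable_chainPath
  have hpath : ∀ (n : ℕ) (x : ℕ → ℕ+), P.map F {y | ∀ i ≤ n, y i = x i} =
      π {x 0} * ∏ i ∈ Finset.range n, ENNReal.ofReal (q (x i) (x (i + 1))) := by
    intro n x
    have hset : F ⁻¹' {y | ∀ i ≤ n, y i = x i} =
        {x 0} ×ˢ Set.pi ((Finset.range n).image fun i => (i, x i)) fun p => {x (p.1 + 1)} := by
      ext p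
      simp [F, chainPath_eq_iff]
    have hmeas : MeasurableSet {y : ℕ → ℕ+ | ∀ i ≤ n, y i = x i} := by
      simp only [Set.ofPred_forall]
      exact .iInter fun i => .iInter fun _ =>
        measurableSet_eq_fun (measurable_pi_apply i) measurable_const
    rw [Measure.map_apply hF hmeas, hset, Measure.prod_prod,
      Measure.infinitePi_pi _ fun _ _ => measurableSet_singleton _, Finset.prod_image]
    · simp only [stepMeasure, Measure.sum_smul_dirac_singleton]
    · intro i _ j _ hij
      exact congrArg Prod.fst hij
  refine ⟨P.map F, Measure.isProbabilityMeasure_map hF.aemeasurable,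
    ⟨fun j => measurable_pi_apply j, fun n x => ?_⟩, ?_⟩
  · rw [measureReal_def, measureReal_def, hpath, hpath, Finset.prod_range_succ, ← mul_assoc,
      ENNReal.toReal_mul, ENNReal.toReal_ofReal (h0 _ _)]
  · rw [Measure.map_map (measurable_pi_apply 0) hF]
    exact Measure.map_fst_prod.trans (by simp)

variable {Ω : Type*} [MeasurableSpace Ω] {μ : Measure Ω} {Q : ℕ → Ω → ℕ+}

theorem IsMarkovChain.measurableSet_eq (hQ : IsMarkovChain q Q μ) (j : ℕ) (a : ℕ+) :
    MeasurableSet {ω | Q j ω = a} :=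
  measurableSet_eq_fun (hQ.measurable j) measurable_const

variable [IsProbabilityMeasure μ]

theorem IsMarkovChain.measure_path (hQ : IsMarkovChain q Q μ)
    (n : ℕ) (x : ℕ → ℕ+) :
    μ {ω | ∀ i ≤ n, Q i ω = x i} =
      μ {ω | Q 0 ω = x 0} * ∏ i ∈ Finset.range n, ENNReal.ofReal (q (x i) (x (i + 1))) := by
  induction n with
  | zero => simp
  | succ n ih =>
    rw [Finset.prod_range_succ, ← mul_assoc, ← ih, ← ofReal_measureReal, hQ.step,
      ENNReal.ofReal_mul measureReal_nonneg, ofReal_measureReal]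

/-- The Markov property for a single time, with the past before it summed out. -/
theorem IsMarkovChain.measure_step (hQ : IsMarkovChain q Q μ) (j : ℕ) (a b : ℕ+) :
    μ ({ω | Q j ω = a} ∩ {ω | Q (j + 1) ω = b}) = μ {ω | Q j ω = a} * ENNReal.ofReal (q a b) := by
  let Φ : Ω → Fin (j + 1) → ℕ+ := fun ω i => Q i ω
  have hΦ : Measurable Φ := measurable_pi_lambda _ fun i => hQ.measurable i
  let S : Set (Fin (j + 1) → ℕ+) := {y | y (Fin.last j) = a}
  have hS : {ω | Q j ω = a} = Φ ⁻¹' S := by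
    ext ω; simp [Φ, S]
  have hB : MeasurableSet {ω | Q (j + 1) ω = b} := hQ.measurableSet_eq (j + 1) b
  have hsing : ∀ y, MeasurableSet (Φ ⁻¹' {y}) := fun y => hΦ (measurableSet_singleton y)
  rw [hS, ← Measure.restrict_apply' hB,
    ← tsum_measure_preimage_singleton S.to_countable fun y _ => hsing y,
    ← tsum_measure_preimage_singleton S.to_countable fun y _ => hsing y, ← ENNReal.tsum_mul_right]
  refine tsum_congr fun ⟨y, hy⟩ => ?_
  let x : ℕ → ℕ+ := fun i => if h : i < j + 1 then y ⟨i, h⟩ else b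
  have hj : x j = a := (dif_pos j.lt_succ_self).trans hy
  have hj' : x (j + 1) = b := by simp [x]
  have h1 : Φ ⁻¹' {y} = {ω | ∀ i ≤ j, Q i ω = x i} := by
    ext ω
    simp only [Set.mem_preimage, Set.mem_singleton_iff, funext_iff, Set.mem_ofPred_eq, Φ,
      Fin.forall_iff, Nat.lt_succ_iff]
    refine forall₂_congr fun i hi => ?_
    rw [show x i = y ⟨i, Nat.lt_succ_iff.2 hi⟩ from dif_pos (Nat.lt_succ_iff.2 hi)]
  have h2 : Φ ⁻¹' {y} ∩ {ω | Q (j + 1) ω = b} = {ω | ∀ i ≤ j + 1, Q i ω = x i} := by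
    ext ω
    rw [h1]
    simp only [Set.mem_inter_iff, Set.mem_ofPred_eq, Nat.le_succ_iff, or_imp, forall_and,
      forall_eq, hj']
  rw [Measure.restrict_apply' hB, h2, h1, hQ.measure_path, hQ.measure_path,
    Finset.prod_range_succ, hj, hj', mul_assoc]

theorem IsMarkovChain.cond_step (hQ : IsMarkovChain q Q μ) {j : ℕ} {a : ℕ+}
    (ha : μ {ω | Q j ω = a} ≠ 0) (b : ℕ+) :
    (μ[|{ω | Q j ω = a}]) {ω | Q (j + 1) ω = b} = ENNReal.ofReal (q a b) := by
  rw [cond_apply (hQ.measurableSet_eq j a), hQ.measure_step, ← mul_assoc,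
    ENNReal.inv_mul_cancel ha (measure_ne_top _ _), one_mul]

theorem IsMarkovChain.cond_path (hQ : IsMarkovChain q Q μ) {a : ℕ+}
    (ha : μ {ω | Q 0 ω = a} ≠ 0) (n : ℕ) {x : ℕ → ℕ+} (hx : x 0 = a) :
    (μ[|{ω | Q 0 ω = a}]) {ω | ∀ i ≤ n, Q i ω = x i} =
      ∏ i ∈ Finset.range n, ENNReal.ofReal (q (x i) (x (i + 1))) := by
  have : {ω | Q 0 ω = a} ∩ {ω | ∀ i ≤ n, Q i ω = x i} = {ω | ∀ i ≤ n, Q i ω = x i} := by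
    refine Set.inter_eq_right.2 fun ω hω => ?_
    rw [Set.mem_ofPred_eq, hω 0 (Nat.zero_le n), hx]
  rw [cond_apply (hQ.measurableSet_eq 0 a), this, hQ.measure_path, hx,
    ← mul_assoc, ENNReal.inv_mul_cancel ha (measure_ne_top _ _), one_mul]

theorem IsMarkovChain.ae_monotone (hQ : IsMarkovChain q Q μ) (h : ∀ a b, b < a → q a b = 0) :
    ∀ᵐ ω ∂μ, Monotone fun j => Q j ω := by
  have : ∀ᵐ ω ∂μ, ∀ (j : ℕ) (a b : ℕ+), b < a → ¬ (Q j ω = a ∧ Q (j + 1) ω = b) := by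
    simp only [ae_all_iff]
    intro j a b hab
    have h0 := hQ.measure_step j a b
    rw [h a b hab, ENNReal.ofReal_zero, mul_zero] at h0
    rw [ae_iff]
    simpa [Set.inter_def] using h0
  filter_upwards [this] with ω hω
  exact monotone_nat_of_le_succ fun j => not_lt.1 fun hlt => hω j _ _ hlt ⟨rfl, rfl⟩

end MarkovChain

/-! ### The law of the sample -/

section BoxMeasure

variable (w : ℕ → unitInterval)

/-- The mass `(1 - w 0) ⋯ (1 - w (k - 1))` left outside the first `k` boxes. The factors are
indexed from `0`, so that box `b + 1` has the factor `w b`. -/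
noncomputable def tailMass (k : ℕ) : ℝ≥0∞ :=
  ∏ j ∈ Finset.range k, ENNReal.ofReal (1 - (w j : ℝ))

/-- The discrete distribution on the boxes obtained by stick breaking with the factors
`w 0, w 1, …`. It is in general only a sub-probability measure. -/
noncomputable def boxMeasure : Measure ℕ+ :=
  Measure.sum fun b : ℕ => (tailMass w b * ENNReal.ofReal (w b)) • Measure.dirac b.succPNat

variable {w}

theorem ofReal_one_sub_add_ofReal (t : unitInterval) :
    ENNReal.ofReal (t : ℝ) + ENNReal.ofReal (1 - (t : ℝ)) = 1 := by
  rw [← ENNReal.ofReal_add t.2.1 (sub_nonneg.2 t.2.2)]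
  simp

theorem tailMass_ne_top (k : ℕ) : tailMass w k ≠ ⊤ :=
  ENNReal.prod_ne_top fun _ _ => ENNReal.ofReal_ne_top

theorem sum_tailMass_add_tailMass (k : ℕ) :
    ∑ b ∈ Finset.range k, tailMass w b * ENNReal.ofReal (w b) + tailMass w k = 1 := by
  induction k with
  | zero => simp [tailMass]
  | succ k ih =>
    have h : tailMass w (k + 1) = tailMass w k * ENNReal.ofReal (1 - (w k : ℝ)) :=
      Finset.prod_range_succ _ k
    rw [Finset.sum_range_succ, h, add_assoc, ← mul_add, ofReal_one_sub_add_ofReal, mul_one, ih]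

theorem lintegral_boxMeasure (f : ℕ+ → ℝ≥0∞) :
    ∫⁻ i, f i ∂boxMeasure w =
      ∑' b : ℕ, tailMass w b * ENNReal.ofReal (w b) * f b.succPNat := by
  simp [boxMeasure, lintegral_sum_measure, lintegral_smul_measure]

theorem boxMeasure_univ : boxMeasure w Set.univ = ∑' b : ℕ, tailMass w b * ENNReal.ofReal (w b) := by
  rw [← lintegral_one, lintegral_boxMeasure]
  simp

theorem boxMeasure_singleton (b : ℕ) :
    boxMeasure w {b.succPNat} = tailMass w b * ENNReal.ofReal (w b) := by
  rw [← lintegral_indicator_one (measurableSet_singleton _), lintegral_boxMeasure,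
    tsum_eq_single b]
  · simp
  · intro b' hb'
    simp [Nat.succPNat_injective.ne hb']

instance isFiniteMeasure_boxMeasure : IsFiniteMeasure (boxMeasure w) := by
  refine ⟨lt_of_le_of_lt ?_ ENNReal.one_lt_top⟩
  rw [boxMeasure_univ]
  refine ENNReal.tsum_le_of_sum_range_le fun k => ?_
  rw [← sum_tailMass_add_tailMass (w := w) k]
  exact le_self_add

theorem tsum_tailMass_add (h : boxMeasure w Set.univ = 1) (k : ℕ) :
    ∑' b : ℕ, tailMass w (b + k) * ENNReal.ofReal (w (b + k)) = tailMass w k := by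
  have h1 := sum_tailMass_add_tailMass (w := w) k
  rw [← h, boxMeasure_univ, ← Summable.sum_add_tsum_nat_add' (k := k) ENNReal.summable] at h1
  refine ((ENNReal.add_right_inj ?_).1 h1).symm
  exact ENNReal.sum_ne_top.2 fun b _ =>
    ENNReal.mul_ne_top (tailMass_ne_top b) ENNReal.ofReal_ne_top

theorem boxMeasure_setOf_lt (h : boxMeasure w Set.univ = 1) (k : ℕ) :
    boxMeasure w {i | k < (i : ℕ)} = tailMass w k := by
  rw [← lintegral_indicator_one (.of_discrete), lintegral_boxMeasure,
    ← Summable.sum_add_tsum_nat_add' (k := k) ENNReal.summable, ← tsum_tailMass_add h k, Finset.sum_eq_zero, zero_add]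
  · refine tsum_congr fun b => ?_
    rw [Set.indicator_of_mem]
    · simp
    · simp [Nat.succPNat_coe]
  · intro b hb
    rw [Set.indicator_of_notMem, mul_zero]
    simp at hb ⊢
    omega

end BoxMeasure

section Sample

variable {Ω : Type*}
  {W : ℕ+ → Ω → unitInterval} {X : ℕ → Ω → ℕ+}

theorem ramWeight_nonneg (i : ℕ+) (ω : Ω) : 0 ≤ ramWeight W i ω :=
  mul_nonneg (Finset.prod_nonneg fun j _ => sub_nonneg.2 (W j ω).2.2) (W i ω).2.1

theorem Iio_succPNat (b : ℕ) :
    Finset.Iio b.succPNat = (Finset.range b).map ⟨Nat.succPNat, Nat.succPNat_injective⟩ := by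
  ext i
  simp only [Finset.mem_Iio, Finset.mem_map, Finset.mem_range, Function.Embedding.coeFn_mk]
  constructor
  · intro h
    refine ⟨i.natPred, ?_, PNat.succPNat_natPred i⟩
    have h1 : (i : ℕ) < b + 1 := h
    have h2 := PNat.natPred_add_one i
    omega
  · rintro ⟨a, ha, rfl⟩
    exact Nat.succPNat_strictMono ha

/-- The factors of the residual allocation model, indexed from `0`. -/
def sticks (W : ℕ+ → Ω → unitInterval) (ω : Ω) (j : ℕ) : unitInterval := W j.succPNat ω

theorem boxMeasure_sticks_singleton (ω : Ω) (i : ℕ+) :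
    boxMeasure (sticks W ω) {i} = ENNReal.ofReal (ramWeight W i ω) := by
  obtain ⟨b, rfl⟩ : ∃ b : ℕ, b.succPNat = i := ⟨i.natPred, PNat.succPNat_natPred i⟩
  rw [boxMeasure_singleton, ramWeight, Iio_succPNat, Finset.prod_map,
    ENNReal.ofReal_mul (Finset.prod_nonneg fun j _ => sub_nonneg.2 (W _ ω).2.2),
    ENNReal.ofReal_prod_of_nonneg fun j _ => sub_nonneg.2 (W _ ω).2.2]
  rfl

variable [MeasurableSpace Ω] {μ : Measure Ω}

theorem measurable_ramWeight (hW : ∀ i, Measurable (W i)) (i : ℕ+) : Measurable (ramWeight W i) := by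
  unfold ramWeight
  fun_prop

variable [IsProbabilityMeasure μ]

/-- The joint law of the first `n` balls is a mixture of product measures. -/
theorem IsSampleFrom.measure_eq_lintegral_pi (hW : ∀ i, Measurable (W i))
    (hX : IsSampleFrom (ramWeight W) X μ) (n : ℕ) (S : Set (Fin n → ℕ+)) :
    μ ((fun ω (i : Fin n) => X i ω) ⁻¹' S) =
      ∫⁻ ω, Measure.pi (fun _ : Fin n => boxMeasure (sticks W ω)) S ∂μ := by
  have hpi : ∀ (y : Fin n → ℕ+) (ω : Ω), Measure.pi (fun _ : Fin n => boxMeasure (sticks W ω)) {y} =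
      ENNReal.ofReal (∏ i, ramWeight W (y i) ω) := by
    intro y ω
    rw [← Set.univ_pi_singleton, Measure.pi_pi,
      ENNReal.ofReal_prod_of_nonneg fun i _ => ramWeight_nonneg _ _]
    simp_rw [boxMeasure_sticks_singleton]
  have hmeas : ∀ y : Fin n → ℕ+, Measurable fun ω => ENNReal.ofReal (∏ i, ramWeight W (y i) ω) :=
    fun y => (Finset.measurable_fun_prod _ fun i _ => measurable_ramWeight hW (y i)).ennreal_ofReal
  have hsing : ∀ y : Fin n → ℕ+, μ ((fun ω (i : Fin n) => X i ω) ⁻¹' {y}) =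
      ∫⁻ ω, ENNReal.ofReal (∏ i, ramWeight W (y i) ω) ∂μ := by
    intro y
    let x : ℕ → ℕ+ := fun i => if h : i < n then y ⟨i, h⟩ else 1
    have hx : ∀ i : Fin n, x i = y i := fun i => dif_pos i.2
    have hset : (fun ω (i : Fin n) => X i ω) ⁻¹' {y} = {ω | ∀ i < n, X i ω = x i} := by
      ext ω
      simp only [Set.mem_preimage, Set.mem_singleton_iff, funext_iff, Set.mem_ofPred_eq, ← hx,
        Fin.forall_iff]
    have hA : MeasurableSet {ω | ∀ i < n, X i ω = x i} := by
      simp only [Set.ofPred_forall]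
      exact .iInter fun i => .iInter fun _ =>
        measurableSet_eq_fun (hX.measurable i) measurable_const
    have hle : MeasurableSpace.comap (fun ω (i : ℕ+) => ramWeight W i ω) inferInstance ≤
        (inferInstance : MeasurableSpace Ω) :=
      (measurable_pi_lambda _ fun i => measurable_ramWeight hW i).comap_le
    have hc := hX.cond_law n x
    have hprod : (fun ω => ∏ i ∈ Finset.range n, ramWeight W (x i) ω) =
        fun ω => ∏ i : Fin n, ramWeight W (y i) ω := by
      funext ω
      rw [Finset.prod_range]
      simp_rw [hx]
    rw [hprod] at hc
    have hint := integrable_condExp.congr hc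
    have hI := integral_condExp hle (μ := μ)
      (f := {ω | ∀ i < n, X i ω = x i}.indicator fun _ => (1 : ℝ))
    rw [integral_congr_ae hc, integral_indicator_const _ hA, smul_eq_mul, mul_one] at hI
    rw [← ofReal_integral_eq_lintegral_ofReal hint (ae_of_all _ fun ω =>
      Finset.prod_nonneg fun i _ => ramWeight_nonneg _ _), hI, hset, ofReal_measureReal]
  have hXm : Measurable fun ω (i : Fin n) => X i ω :=
    measurable_pi_lambda _ fun i => hX.measurable i
  rw [← tsum_measure_preimage_singleton S.to_countable fun y _ => hXm (measurableSet_singleton y)]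
  simp_rw [hsing]
  rw [← lintegral_tsum fun y : S => (hmeas y).aemeasurable]
  refine lintegral_congr fun ω => ?_
  simp_rw [← hpi]
  exact tsum_measure_preimage_singleton (f := id) S.to_countable fun y _ =>
    measurableSet_singleton y

/-- Since a ball does land in some box, the random discrete distribution is proper. -/
theorem IsSampleFrom.ae_boxMeasure_univ (hW : ∀ i, Measurable (W i))
    (hX : IsSampleFrom (ramWeight W) X μ) : ∀ᵐ ω ∂μ, boxMeasure (sticks W ω) Set.univ = 1 := by
  have h := hX.measure_eq_lintegral_pi hW 1 Set.univ
  simp only [Set.preimage_univ, measure_univ, Measure.pi_univ, Finset.univ_unique,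
    Finset.prod_singleton] at h
  have hle : ∀ ω, boxMeasure (sticks W ω) Set.univ ≤ 1 := by
    intro ω
    rw [boxMeasure_univ]
    refine ENNReal.tsum_le_of_sum_range_le fun k => ?_
    rw [← sum_tailMass_add_tailMass (w := sticks W ω) k]
    exact le_self_add
  have := ae_eq_of_ae_le_of_lintegral_le (μ := μ) (f := fun ω => boxMeasure (sticks W ω) Set.univ)
    (g := fun _ => 1) (ae_of_all _ hle) (by rw [← h]; simp) aemeasurable_const (by rw [← h]; simp)
  exact this

end Sample

/-! ### Occupancy counts of independent balls -/

section Thinning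

variable {R : Type*} [CommSemiring R]

/-- The binomial weight of `M` survivors among `N` items, each of them removed with weight `a` and
kept with weight `b`. -/
def thin (a b : R) (N M : ℕ) : R := N.choose M * (a ^ (N - M) * b ^ M)

theorem thin_zero_zero (a b : R) : thin a b 0 0 = 1 := by simp [thin]

theorem thin_zero_of_ne (a b : R) {M : ℕ} (h : M ≠ 0) : thin a b 0 M = 0 := by
  simp [thin, Nat.choose_eq_zero_of_lt (Nat.pos_of_ne_zero h)]

theorem thin_succ_zero (a b : R) (N : ℕ) : thin a b (N + 1) 0 = a * thin a b N 0 := by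
  simp [thin, pow_succ']

theorem thin_succ_succ (a b : R) (N M : ℕ) :
    thin a b (N + 1) (M + 1) = a * thin a b N (M + 1) + b * thin a b N M := by
  unfold thin
  rw [Nat.choose_succ_succ, Nat.add_sub_add_right]
  rcases Nat.lt_or_ge M N with h | h
  · obtain ⟨d, rfl⟩ := Nat.exists_eq_add_of_lt h
    rw [show M + d + 1 - M = d + 1 by omega, show M + d + 1 - (M + 1) = d by omega]
    push_cast
    ring
  · rw [Nat.choose_eq_zero_of_lt (show N < M + 1 by omega)]
    push_cast
    ring

/-- The weight of the counts `c 0, …, c k` in `k` successive thinnings. -/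
def thinProd (a b : ℕ → R) (k : ℕ) (c : ℕ → ℕ) : R :=
  ∏ j ∈ Finset.range k, thin (a j) (b j) (c j) (c (j + 1))

/-- The counts after the removal of one item that survived exactly the first `r` thinnings. -/
def decrUpTo (r : ℕ) (c : ℕ → ℕ) (j : ℕ) : ℕ := if j ≤ r then c j - 1 else c j

/-- The contribution to `thinProd` of the configurations in which a given item survived exactly the
first `r` thinnings. -/
def thinDecr (a b : ℕ → R) (k r : ℕ) (c : ℕ → ℕ) : R :=
  if ∀ j ≤ r, 1 ≤ c j then thinProd a b k (decrUpTo r c) else 0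

theorem thinDecr_succ (a b : ℕ → R) {k r : ℕ} (hr : r < k) (c : ℕ → ℕ) :
    thinDecr a b (k + 1) r c = thinDecr a b k r c * thin (a k) (b k) (c k) (c (k + 1)) := by
  unfold thinDecr
  split_ifs
  · rw [thinProd, Finset.prod_range_succ, decrUpTo, decrUpTo, if_neg (by omega), if_neg (by omega)]
    rfl
  · rw [zero_mul]

theorem thinDecr_last (a b : ℕ → R) (k : ℕ) (c : ℕ → ℕ) :
    thinDecr a b k k c * thin (a k) (b k) (c k) (c (k + 1)) =
      a k * thinDecr a b (k + 1) k c + b k * thinDecr a b (k + 1) (k + 1) c := by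
  by_cases h : ∀ j ≤ k, 1 ≤ c j
  · have h1 : ∀ r, k ≤ r → thinProd a b k (decrUpTo r c) = thinProd a b k (decrUpTo k c) := by
      intro r hr
      refine Finset.prod_congr rfl fun j hj => ?_
      have := Finset.mem_range.1 hj
      simp only [decrUpTo]
      rw [if_pos (by omega), if_pos (by omega), if_pos (by omega), if_pos (by omega)]
    have h2 : ∀ r, thinProd a b (k + 1) (decrUpTo r c) = thinProd a b k (decrUpTo r c) *
        thin (a k) (b k) (decrUpTo r c k) (decrUpTo r c (k + 1)) :=
      fun r => Finset.prod_range_succ _ k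
    obtain ⟨N, hN⟩ := Nat.exists_eq_add_of_le' (h k le_rfl)
    unfold thinDecr
    rw [if_pos h, if_pos h, h2, h2, h1 (k + 1) (by omega)]
    have e1 : decrUpTo k c k = N := by simp [decrUpTo, hN]
    have e2 : decrUpTo k c (k + 1) = c (k + 1) := by simp [decrUpTo]
    have e3 : decrUpTo (k + 1) c k = N := by simp [decrUpTo, hN]
    have e4 : decrUpTo (k + 1) c (k + 1) = c (k + 1) - 1 := by simp [decrUpTo]
    rw [e1, e2, e3, e4, hN]
    rcases Nat.eq_zero_or_pos (c (k + 1)) with h0 | h0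
    · rw [h0, thin_succ_zero, if_neg fun h' => by have := h' (k + 1) le_rfl; omega]
      ring
    · obtain ⟨M, hM⟩ := Nat.exists_eq_add_of_le' h0
      have h3 : ∀ j ≤ k + 1, 1 ≤ c j := by
        intro j hj
        rcases Nat.le_succ_iff.1 hj with hj | rfl
        · exact h j hj
        · exact h0
      rw [if_pos h3, hM, thin_succ_succ, Nat.add_sub_cancel]
      ring
  · have h' : ¬ ∀ j ≤ k + 1, 1 ≤ c j := fun h' => h fun j hj => h' j (by omega)
    simp [thinDecr, h, h']

/-- Decomposition of the thinning weight according to the fate of one item. -/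
theorem thinProd_eq_sum (a b : ℕ → R) (k : ℕ) (c : ℕ → ℕ) (hc : 1 ≤ c 0) :
    thinProd a b k c =
      ∑ r ∈ Finset.range k, (∏ j ∈ Finset.range r, b j) * a r * thinDecr a b k r c +
        (∏ j ∈ Finset.range k, b j) * thinDecr a b k k c := by
  induction k with
  | zero => simp [thinProd, thinDecr, hc]
  | succ k ih =>
    rw [show thinProd a b (k + 1) c = thinProd a b k c * thin (a k) (b k) (c k) (c (k + 1)) from
      Finset.prod_range_succ _ k, ih, add_mul, mul_assoc _ (thinDecr a b k k c), thinDecr_last,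
      Finset.sum_mul, Finset.sum_range_succ _ k, Finset.prod_range_succ _ k]
    have : ∀ r ∈ Finset.range k, (∏ j ∈ Finset.range r, b j) * a r * thinDecr a b (k + 1) r c =
        (∏ j ∈ Finset.range r, b j) * a r * thinDecr a b k r c *
          thin (a k) (b k) (c k) (c (k + 1)) := by
      intro r hr
      rw [thinDecr_succ a b (Finset.mem_range.1 hr), ← mul_assoc]
    rw [Finset.sum_congr rfl this]
    ring

theorem thinProd_of_zero (a b : ℕ → R) (k : ℕ) {c : ℕ → ℕ} (hc : c 0 = 0) :
    thinProd a b k c = if ∀ j ≤ k, c j = 0 then 1 else 0 := by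
  induction k with
  | zero => simp [thinProd, hc]
  | succ k ih =>
    rw [show thinProd a b (k + 1) c = thinProd a b k c * thin (a k) (b k) (c k) (c (k + 1)) from
      Finset.prod_range_succ _ k, ih]
    simp only [Nat.le_succ_iff, or_imp, forall_and, forall_eq]
    by_cases h : ∀ j ≤ k, c j = 0
    · rw [if_pos h, h k le_rfl, one_mul]
      by_cases h' : c (k + 1) = 0
      · rw [if_pos ⟨h, h'⟩, h', thin_zero_zero]
      · rw [if_neg fun H => h' H.2, thin_zero_of_ne _ _ h']
    · rw [if_neg h, if_neg fun H => h H.1, zero_mul]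

end Thinning

section Counts

/-- The number of entries of `x` that exceed `j`. -/
def countGt {n : ℕ} (x : Fin n → ℕ+) (j : ℕ) : ℕ := ∑ i, if j < (x i : ℕ) then 1 else 0

theorem countGt_succ {n : ℕ} (x : Fin (n + 1) → ℕ+) (j : ℕ) :
    countGt x j = (if j < (x (Fin.last n) : ℕ) then 1 else 0) + countGt (Fin.init x) j := by
  rw [countGt, Fin.sum_univ_castSucc, add_comm]
  rfl

theorem pi_succ_apply (p : Measure ℕ+) [IsFiniteMeasure p] {n : ℕ} (S : Set (Fin (n + 1) → ℕ+))
    (T : Set (ℕ+ × (Fin n → ℕ+))) (hST : ∀ x, x ∈ S ↔ (x (Fin.last n), Fin.init x) ∈ T) :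
    Measure.pi (fun _ : Fin (n + 1) => p) S = (p.prod (Measure.pi fun _ : Fin n => p)) T := by
  have h := measurePreserving_piFinSuccAbove (fun _ : Fin (n + 1) => p) (Fin.last n)
  rw [← h.measure_preimage (MeasurableSet.of_discrete (s := T)).nullMeasurableSet]
  congr 1
  ext x
  rw [hST]
  simp [MeasurableEquiv.piFinSuccAbove, Fin.init_def, Fin.insertNthEquiv]

variable {w : ℕ → unitInterval}

/-- The weight of successive counts of balls outside the first boxes, for stick breaking
factors `w`. -/
noncomputable def countWeight (w : ℕ → unitInterval) : ℕ → (ℕ → ℕ) → ℝ≥0∞ :=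
  thinProd (fun j => ENNReal.ofReal (w j)) fun j => ENNReal.ofReal (1 - (w j : ℝ))

/-- Successive thinning: of the balls outside the first `j` boxes each is in box `j + 1` with
probability `w j`. -/
theorem pi_boxMeasure_countGt (h : boxMeasure w Set.univ = 1) (k n : ℕ) (c : ℕ → ℕ) :
    Measure.pi (fun _ : Fin n => boxMeasure w) {x | ∀ j ≤ k, countGt x j = c j} =
      if c 0 = n then countWeight w k c else 0 := by
  induction n generalizing c with
  | zero =>
    have h0 : {x : Fin 0 → ℕ+ | ∀ j ≤ k, countGt x j = c j} = {x | ∀ j ≤ k, c j = 0} := by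
      ext x
      simp [countGt, eq_comm]
    rw [h0]
    split_ifs with hc
    · rw [countWeight, thinProd_of_zero _ _ _ hc]
      by_cases h1 : ∀ j ≤ k, c j = 0
      · rw [if_pos h1, show {x : Fin 0 → ℕ+ | ∀ j ≤ k, c j = 0} = Set.univ from
          Set.eq_univ_of_forall fun _ => h1, Measure.pi_univ, Finset.univ_eq_empty,
          Finset.prod_empty]
      · rw [if_neg h1, show {x : Fin 0 → ℕ+ | ∀ j ≤ k, c j = 0} = ∅ from
          Set.eq_empty_of_forall_notMem fun _ => h1, measure_empty]
    · rw [show {x : Fin 0 → ℕ+ | ∀ j ≤ k, c j = 0} = ∅ from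
        Set.eq_empty_of_forall_notMem fun _ hx => hc (hx 0 (Nat.zero_le k)), measure_empty]
  | succ n ih =>
    -- `G r` is the probability of the counts given that the last ball is in box `r + 1`
    let G : ℕ → ℝ≥0∞ := fun r => Measure.pi (fun _ : Fin n => boxMeasure w)
      {x | ∀ j ≤ k, (if j ≤ r then 1 else 0) + countGt x j = c j}
    have hG : ∀ r ≤ k, G r = if c 0 = n + 1 then
        thinDecr (fun j => ENNReal.ofReal (w j)) (fun j => ENNReal.ofReal (1 - (w j : ℝ))) k r c
        else 0 := by
      intro r hr
      by_cases h1 : ∀ j ≤ r, 1 ≤ c j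
      · have h2 : ∀ x : Fin n → ℕ+, (∀ j ≤ k, (if j ≤ r then 1 else 0) + countGt x j = c j) ↔
            ∀ j ≤ k, countGt x j = decrUpTo r c j := by
          intro x
          refine forall₂_congr fun j _ => ?_
          unfold decrUpTo
          split_ifs with hj
          · have := h1 j hj
            omega
          · omega
        have h3 : decrUpTo r c 0 = n ↔ c 0 = n + 1 := by
          have := h1 0 (Nat.zero_le r)
          simp only [decrUpTo, Nat.zero_le, if_true]
          omega
        simp only [G, h2, ih, h3, thinDecr, if_pos h1]
        rfl
      · have h2 : {x : Fin n → ℕ+ | ∀ j ≤ k, (if j ≤ r then 1 else 0) + countGt x j = c j} = ∅ := by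
          refine Set.eq_empty_of_forall_notMem fun x hx => h1 fun j hj => ?_
          have := hx j (hj.trans hr)
          rw [if_pos hj] at this
          omega
        simp only [G, h2, measure_empty, thinDecr, if_neg h1, ite_self]
    have hG' : ∀ r, k ≤ r → G r = G k := by
      intro r hr
      have : ∀ x : Fin n → ℕ+, (∀ j ≤ k, (if j ≤ r then 1 else 0) + countGt x j = c j) ↔
          ∀ j ≤ k, (if j ≤ k then 1 else 0) + countGt x j = c j := by
        intro x
        refine forall₂_congr fun j hj => ?_
        rw [if_pos hj, if_pos (hj.trans hr)]
      simp only [G, this]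
    have hsum : Measure.pi (fun _ : Fin (n + 1) => boxMeasure w)
        {x | ∀ j ≤ k, countGt x j = c j} =
        ∑' r : ℕ, tailMass w r * ENNReal.ofReal (w r) * G r := by
      rw [pi_succ_apply (boxMeasure w) _
        {p | ∀ j ≤ k, (if j < (p.1 : ℕ) then 1 else 0) + countGt p.2 j = c j}
        (fun x => by simp only [Set.mem_ofPred_eq, countGt_succ]),
        Measure.prod_apply .of_discrete, lintegral_boxMeasure]
      refine tsum_congr fun r => ?_
      congr 2
      ext x
      simp
    rw [hsum, ← Summable.sum_add_tsum_nat_add' (k := k) ENNReal.summable]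
    simp_rw [hG' _ (Nat.le_add_left k _)]
    rw [ENNReal.tsum_mul_right, tsum_tailMass_add h,
      Finset.sum_congr rfl fun r hr => by rw [hG r (Finset.mem_range.1 hr).le], hG k le_rfl]
    split_ifs with hc
    · rw [countWeight, thinProd_eq_sum _ _ _ _ (by omega)]
      rfl
    · simp

/-- The counts when the last ball is required to be outside the first `k` boxes; since that
ball counts towards every `c j`, each binomial weight becomes a Pascal weight. -/
theorem pi_boxMeasure_countGt_last (h : boxMeasure w Set.univ = 1) (k n : ℕ) (c : ℕ → ℕ+)
    (hc : (c 0 : ℕ) = n + 1) :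
    Measure.pi (fun _ : Fin (n + 1) => boxMeasure w)
        {x | k < (x (Fin.last n) : ℕ) ∧ ∀ j ≤ k, countGt x j = c j} =
      ∏ j ∈ Finset.range k, ENNReal.ofReal (qHatKernel (c (j + 1)) (c j) (w j)) := by
  rw [pi_succ_apply (boxMeasure w) _
    ({i : ℕ+ | k < (i : ℕ)} ×ˢ {x | ∀ j ≤ k, countGt x j = (fun j => (c j : ℕ) - 1) j}),
    Measure.prod_prod, boxMeasure_setOf_lt h, pi_boxMeasure_countGt h, if_pos (by omega),
    tailMass, countWeight, thinProd, ← Finset.prod_mul_distrib]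
  · refine Finset.prod_congr rfl fun j _ => ?_
    have hw0 := (w j).2.1
    have hw1 := sub_nonneg.2 (w j).2.2
    have hm := (c (j + 1)).pos
    have hn := (c j).pos
    unfold qHatKernel
    split_ifs with hle
    · have hle' : (c (j + 1) : ℕ) ≤ c j := by exact_mod_cast hle
      rw [thin, ← ENNReal.ofReal_pow hw0, ← ENNReal.ofReal_pow hw1,
        ← ENNReal.ofReal_mul (by positivity), ← ENNReal.ofReal_natCast,
        ← ENNReal.ofReal_mul (by positivity), ← ENNReal.ofReal_mul hw1]
      congr 1
      rw [show (c j : ℕ) - 1 - (c (j + 1) - 1) = c j - c (j + 1) by omega]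
      obtain ⟨M, hM⟩ := Nat.exists_eq_add_of_le' hm
      rw [hM, Nat.add_sub_cancel, pow_succ]
      ring
    · have hlt : (c j : ℕ) < c (j + 1) := by exact_mod_cast not_le.1 hle
      rw [thin, Nat.choose_eq_zero_of_lt (by omega)]
      simp
  · intro x
    simp only [Set.mem_ofPred_eq, Set.mem_prod]
    refine and_congr_right fun hk => forall₂_congr fun j hj => ?_
    rw [countGt_succ, if_pos (by omega)]
    have := (c j).pos
    omega

end Counts

/-! ### The reversed counts -/

section OutsideCount

variable {Ω : Type*} {X : ℕ → Ω → ℕ+}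

theorem outsideCount_eq_countGt (n j : ℕ) (ω : Ω) :
    outsideCount X n j ω = countGt (fun i : Fin n => X i ω) j :=
  Finset.sum_range fun i => if j < (X i ω : ℕ) then 1 else 0

theorem outsideCount_succ (n k : ℕ) (ω : Ω) :
    outsideCount X (n + 1) k ω = outsideCount X n k ω + if k < (X n ω : ℕ) then 1 else 0 :=
  Finset.sum_range_succ _ n

theorem outsideCount_mono (k : ℕ) (ω : Ω) : Monotone fun n => outsideCount X n k ω :=
  monotone_nat_of_le_succ fun n => by
    rw [outsideCount_succ]
    exact Nat.le_add_right _ _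

/-- If ball `n` is outside the first `k` boxes, it is the ball that makes the count reach its
current value. -/
theorem hitTime_eq {k n m : ℕ} {ω : Ω} (hn : k < (X n ω : ℕ))
    (hm : outsideCount X (n + 1) k ω = m) : hitTime X k m ω = n + 1 := by
  refine le_antisymm (Nat.sInf_le hm) (le_csInf ⟨_, hm⟩ fun l hl => ?_)
  by_contra! hlt
  have h1 := outsideCount_mono (X := X) k ω (Nat.lt_succ_iff.1 hlt)
  have h2 := outsideCount_succ (X := X) n k ω
  rw [if_pos hn, hm] at h2
  simp only [Set.mem_ofPred_eq] at hl
  simp only at h1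
  omega

variable [MeasurableSpace Ω]

theorem measurable_outsideCount (hX : ∀ i, Measurable (X i)) (n k : ℕ) :
    Measurable (outsideCount X n k) := by
  unfold outsideCount
  refine Finset.measurable_fun_sum _ fun i _ => ?_
  exact (measurable_of_countable fun a : ℕ+ => if k < (a : ℕ) then 1 else 0).comp (hX i)

theorem measurable_hitTime (hX : ∀ i, Measurable (X i)) (k m : ℕ) :
    Measurable (hitTime X k m) := by
  have hP : ∀ n, MeasurableSet {ω | outsideCount X n k ω = m} := fun n =>
    measurableSet_eq_fun (measurable_outsideCount hX n k) measurable_const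
  refine measurable_to_countable' fun n => ?_
  have hset : hitTime X k m ⁻¹' {n} =
      ({ω | outsideCount X n k ω = m} ∩ ⋂ l, ⋂ (_ : l < n), {ω | outsideCount X l k ω = m}ᶜ) ∪
        ({_ω | n = 0} ∩ ⋂ l, {ω | outsideCount X l k ω = m}ᶜ) := by
    ext ω
    simp only [Set.mem_preimage, Set.mem_singleton_iff, hitTime, Set.mem_union, Set.mem_inter_iff,
      Set.mem_iInter, Set.mem_compl_iff, Set.mem_ofPred_eq]
    rcases Set.eq_empty_or_nonempty {n : ℕ | outsideCount X n k ω = m} with he | hne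
    · have he' : ∀ l, outsideCount X l k ω ≠ m := fun l hl => Set.eq_empty_iff_forall_notMem.1 he l hl
      simp [he', eq_comm]
    · constructor
      · rintro rfl
        exact Or.inl ⟨Nat.sInf_mem hne, fun l hl => Nat.notMem_of_lt_sInf (s := {n | outsideCount X n k ω = m}) hl⟩
      · rintro (⟨h1, h2⟩ | ⟨_, h2⟩)
        · refine le_antisymm (Nat.sInf_le h1) (le_csInf ⟨_, h1⟩ fun l hl => ?_)
          exact not_lt.1 fun hlt => h2 l hlt hl
        · obtain ⟨l, hl⟩ := hne
          exact absurd hl (h2 l)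
  rw [hset]
  exact ((hP n).inter (.iInter fun l => .iInter fun _ => (hP l).compl)).union
    ((MeasurableSet.const _).inter (.iInter fun l => (hP l).compl))

/-- The counts of balls outside the first `k`, `k - 1`, …, `0` boxes, at the time when the first of
them reaches `m`. -/
noncomputable def reversedCounts (X : ℕ → Ω → ℕ+) (k m : ℕ) (ω : Ω) (j : Fin (k + 1)) : ℕ :=
  outsideCount X (hitTime X k m ω) (k - (j : ℕ)) ω

theorem measurable_reversedCounts (hX : ∀ i, Measurable (X i)) (k m : ℕ) :
    Measurable (reversedCounts X k m) := by
  refine measurable_pi_lambda _ fun j => ?_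
  have h : Measurable fun p : ℕ × Ω => outsideCount X p.1 (k - (j : ℕ)) p.2 :=
    measurable_from_prod_countable_right fun n => measurable_outsideCount hX n _
  exact h.comp ((measurable_hitTime hX k m).prodMk measurable_id)

end OutsideCount

section Law

variable {Ω : Type*} [MeasurableSpace Ω] {μ : Measure Ω} [IsProbabilityMeasure μ]
  {ν : Measure unitInterval} {W : ℕ+ → Ω → unitInterval} {X : ℕ → Ω → ℕ+}

theorem IsStickBreaking.isProbabilityMeasure (hW : IsStickBreaking ν W μ) :
    IsProbabilityMeasure ν := by
  rw [← hW.law 1]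
  exact Measure.isProbabilityMeasure_map (hW.measurable 1).aemeasurable

/-- The probability that ball `c 0`, which has index `n` in `X`, is outside the first `k` boxes and
that `c j` of the first `c 0` balls are outside the first `j` boxes, for `j = 0, …, k`. -/
theorem measure_counts (hW : IsStickBreaking ν W μ) (hX : IsSampleFrom (ramWeight W) X μ)
    (k n : ℕ) (c : ℕ → ℕ+) (hc : (c 0 : ℕ) = n + 1) :
    μ {ω | k < (X n ω : ℕ) ∧ ∀ j ≤ k, outsideCount X (n + 1) j ω = c j} =
      ∏ j ∈ Finset.range k, ENNReal.ofReal (qHat ν (c (j + 1)) (c j)) := by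
  have := hW.isProbabilityMeasure
  have hset : {ω | k < (X n ω : ℕ) ∧ ∀ j ≤ k, outsideCount X (n + 1) j ω = c j} =
      (fun ω (i : Fin (n + 1)) => X i ω) ⁻¹'
        {x | k < (x (Fin.last n) : ℕ) ∧ ∀ j ≤ k, countGt x j = c j} := by
    ext ω
    simp [outsideCount_eq_countGt]
  have hind : iIndepFun (fun (j : ℕ) ω =>
      ENNReal.ofReal (qHatKernel (c (j + 1)) (c j) (sticks W ω j))) μ :=
    (hW.indep.precomp Nat.succPNat_injective).comp
      (fun j t => ENNReal.ofReal (qHatKernel (c (j + 1)) (c j) t))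
      fun j => (continuous_qHatKernel _ _).measurable.ennreal_ofReal
  rw [hset, hX.measure_eq_lintegral_pi hW.measurable]
  trans ∫⁻ ω, ∏ j ∈ Finset.range k,
      ENNReal.ofReal (qHatKernel (c (j + 1)) (c j) (sticks W ω j)) ∂μ
  · refine lintegral_congr_ae ?_
    filter_upwards [hX.ae_boxMeasure_univ hW.measurable] with ω hω
    exact pi_boxMeasure_countGt_last hω k n c hc
  · rw [lintegral_prod_eq_prod_lintegral_of_indepFun _ _ hind fun j =>
      ((continuous_qHatKernel _ _).measurable.comp (hW.measurable _)).ennreal_ofReal]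
    refine Finset.prod_congr rfl fun j _ => ?_
    rw [ofReal_qHat, ← hW.law j.succPNat,
      lintegral_map (continuous_qHatKernel _ _).measurable.ennreal_ofReal (hW.measurable _)]
    rfl

/-- The joint law of the reversed counts dominates, hence is, that of the chain: the path `z` of the
chain has the probability of an event on which `z` is the sequence of reversed counts. -/
theorem identDistrib_reversedCounts (hW : IsStickBreaking ν W μ)
    (hX : IsSampleFrom (ramWeight W) X μ) {Ω' : Type*} [MeasurableSpace Ω'] {μ' : Measure Ω'}
    [IsProbabilityMeasure μ'] {Q : ℕ → Ω' → ℕ+} (hQ : IsMarkovChain (qHat ν) Q μ')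
    (k : ℕ) (m : ℕ+) (hm : μ' {ω | Q 0 ω = m} ≠ 0) :
    IdentDistrib (reversedCounts X k m) (fun ω (j : Fin (k + 1)) => (Q (j : ℕ) ω : ℕ))
      μ (μ'[|{ω | Q 0 ω = m}]) := by
  have hYm := measurable_reversedCounts hX.measurable k m
  have hQm : Measurable fun ω (j : Fin (k + 1)) => (Q (j : ℕ) ω : ℕ) :=
    measurable_pi_lambda _ fun j => (measurable_of_countable _).comp (hQ.measurable j)
  have hprob : IsProbabilityMeasure (μ'[|{ω | Q 0 ω = m}]) := cond_isProbabilityMeasure hm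
  have := Measure.isProbabilityMeasure_map (μ := μ) hYm.aemeasurable
  have := Measure.isProbabilityMeasure_map (μ := μ'[|{ω | Q 0 ω = m}]) hQm.aemeasurable
  refine ⟨hYm.aemeasurable, hQm.aemeasurable, Eq.symm ?_⟩
  refine Measure.eq_of_le_of_measure_univ_eq ?_ (by simp)
  have hle : ∀ y : Fin (k + 1) → ℕ,
      (μ'[|{ω | Q 0 ω = m}]).map (fun ω (j : Fin (k + 1)) => (Q (j : ℕ) ω : ℕ)) {y} ≤
        μ.map (reversedCounts X k m) {y} := by
    intro y
    rw [Measure.map_apply hQm (measurableSet_singleton y),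
      Measure.map_apply hYm (measurableSet_singleton y)]
    by_cases hy : ∃ z : ℕ → ℕ+, z 0 = m ∧ ∀ j : Fin (k + 1), y j = z j
    · obtain ⟨z, hz0, hz⟩ := hy
      have h1 : (fun ω (j : Fin (k + 1)) => (Q (j : ℕ) ω : ℕ)) ⁻¹' {y} =
          {ω | ∀ i ≤ k, Q i ω = z i} := by
        ext ω
        simp only [Set.mem_preimage, Set.mem_singleton_iff, funext_iff, hz, PNat.coe_inj,
          Set.mem_ofPred_eq, Fin.forall_iff, Nat.lt_succ_iff]
      obtain ⟨n, hn⟩ := Nat.exists_eq_add_of_le' (z k).pos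
      have h2 := measure_counts hW hX k n (fun j => z (k - j)) hn
      rw [h1, hQ.cond_path hm k hz0, ← Finset.prod_range_reflect]
      refine Eq.trans_le ?_ (h2.symm.trans_le (measure_mono ?_))
      · refine Finset.prod_congr rfl fun j hj => ?_
        have := Finset.mem_range.1 hj
        rw [show k - 1 - j = k - (j + 1) by omega, show k - (j + 1) + 1 = k - j by omega]
      · rintro ω ⟨hlast, hcount⟩
        have hk := hcount k le_rfl
        simp only [Nat.sub_self, hz0] at hk
        ext j
        have hj := j.2
        rw [reversedCounts, hitTime_eq hlast hk, hcount _ (Nat.sub_le k j), hz]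
        congr 2
        omega
    · have h1 : {ω | Q 0 ω = m} ∩ (fun ω (j : Fin (k + 1)) => (Q (j : ℕ) ω : ℕ)) ⁻¹' {y} = ∅ := by
        refine Set.eq_empty_of_forall_notMem fun ω hω => hy ⟨fun j => Q j ω, hω.1, fun j => ?_⟩
        exact (congrFun hω.2 j).symm
      rw [cond_apply (hQ.measurableSet_eq 0 m), h1, measure_empty, mul_zero]
      exact bot_le
  refine Measure.le_iff.2 fun S _ => ?_
  have hS : ∀ ρ : Measure (Fin (k + 1) → ℕ), ρ S = ∑' y : S, ρ {(y : Fin (k + 1) → ℕ)} := fun ρ =>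
    (tsum_measure_preimage_singleton (f := id) S.to_countable fun y _ =>
      measurableSet_singleton y).symm
  rw [hS, hS]
  exact ENNReal.tsum_le_tsum fun y => hle y

theorem exists_isMarkovChain_qHat (hW : IsStickBreaking ν W μ) (m : ℕ+) :
    ∃ κ : Measure (ℕ → ℕ+), IsProbabilityMeasure κ ∧ IsMarkovChain (qHat ν) (fun j x => x j) κ ∧
      κ {x | x 0 = m} ≠ 0 := by
  have := hW.isProbabilityMeasure
  obtain ⟨κ, hκ, hQ, hκ0⟩ := exists_isMarkovChain qHat_nonneg (hasSum_qHat hW.mem_Ioo)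
    (Measure.dirac m)
  refine ⟨κ, hκ, hQ, ?_⟩
  have hm : κ.map (fun x => x 0) {m} = 1 := by
    rw [hκ0, Measure.dirac_apply_of_mem (Set.mem_singleton m)]
  rw [Measure.map_apply (measurable_pi_apply 0) (measurableSet_singleton m)] at hm
  change κ ((fun x => x 0) ⁻¹' {m}) ≠ 0
  rw [hm]
  exact one_ne_zero

/-- The count outside the first `k` boxes almost surely takes the value `m`, because the reversed
counts are distributed like a chain started at `m`. -/
theorem ae_exists_outsideCount_eq (hW : IsStickBreaking ν W μ)
    (hX : IsSampleFrom (ramWeight W) X μ) (k : ℕ) (m : ℕ+) :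
    ∀ᵐ ω ∂μ, ∃ n, outsideCount X n k ω = m := by
  obtain ⟨κ, hκ, hQ, hm⟩ := exists_isMarkovChain_qHat hW m
  have hid := identDistrib_reversedCounts hW hX hQ k m hm
  have h := hid.symm.ae_snd (p := fun y => y 0 = m)
    (measurableSet_eq_fun (measurable_pi_apply 0) measurable_const) (by
      filter_upwards [ae_cond_mem (hQ.measurableSet_eq 0 m)] with x hx
      exact congrArg PNat.val hx)
  filter_upwards [h] with ω hω
  exact ⟨_, hω⟩

end Law

/-! ### Blocks of the permutation in order of appearance -/

section Appearance

variable {x : ℕ → ℕ+}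

theorem exists_first_occurrence (l : ℕ) : ∃ j ≤ l, x j = x l ∧ ∀ i < j, x i ≠ x j := by
  classical
  have h : ∃ j, x j = x l := ⟨l, rfl⟩
  refine ⟨Nat.find h, Nat.find_min' h rfl, Nat.find_spec h, fun i hi => ?_⟩
  rw [Nat.find_spec h]
  exact Nat.find_min h hi

theorem eq_of_first_occurrence {a b : ℕ} (ha : ∀ i < a, x i ≠ x a) (hb : ∀ i < b, x i ≠ x b)
    (h : x a = x b) : a = b := by
  rcases lt_trichotomy a b with hab | hab | hab
  · exact absurd h (hb a hab)
  · exact hab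
  · exact absurd h.symm (ha b hab)

theorem infinite_first_occurrence (hx : ∀ k : ℕ, ∃ j, k < (x j : ℕ)) :
    {j | ∀ l < j, x l ≠ x j}.Infinite := by
  intro hfin
  obtain ⟨B, hB⟩ := (hfin.image fun j => (x j : ℕ)).bddAbove
  obtain ⟨l, hl⟩ := hx B
  obtain ⟨j, -, hj, hfirst⟩ := exists_first_occurrence (x := x) l
  have := hB ⟨j, hfirst, rfl⟩
  simp only [hj] at this
  omega

/-- If ball `T` is the first one outside the first `k` boxes, then these boxes form a block of the
order of appearance if and only if all of them are hit before time `T`. -/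
theorem isInitialBlock_appearance_iff (hx : ∀ k : ℕ, ∃ j, k < (x j : ℕ)) {k T : ℕ}
    (hT : k < (x T : ℕ)) (hlt : ∀ l < T, (x l : ℕ) ≤ k) :
    IsInitialBlock (appearance x) k ↔ ∀ i : ℕ+, (i : ℕ) ≤ k → ∃ l < T, x l = i := by
  set p : ℕ → Prop := fun j => ∀ l < j, x l ≠ x j with hp
  have hinf : {j | p j}.Infinite := infinite_first_occurrence hx
  have hmono := Nat.nth_strictMono hinf
  have happ : ∀ i, appearance x i = x (Nat.nth p i.natPred) := fun _ => rfl
  have hpT : p T := fun l hl h => by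
    have := hlt l hl
    rw [h] at this
    omega
  classical
  constructor
  · intro hb i hi
    obtain ⟨i', hi', rfl⟩ := hb.surjOn hi
    refine ⟨Nat.nth p i'.natPred, ?_, rfl⟩
    rw [← Nat.nth_count hpT]
    refine hmono ?_
    by_contra! hle
    have h1 : (Nat.count p T).succPNat ∈ {i : ℕ+ | (i : ℕ) ≤ k} := by
      have := PNat.natPred_add_one i'
      simp only [Set.mem_ofPred_eq, Nat.succPNat_coe] at hi' ⊢
      omega
    have h2 := hb.mapsTo h1
    rw [Set.mem_ofPred_eq, happ, Nat.natPred_succPNat, Nat.nth_count hpT] at h2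
    omega
  · intro h
    have hinj : Function.Injective (appearance x) := by
      intro a b hab
      exact PNat.natPred_injective (hmono.injective (eq_of_first_occurrence
        (Nat.nth_mem_of_infinite hinf _) (Nat.nth_mem_of_infinite hinf _) hab))
    have hfin : {i : ℕ+ | (i : ℕ) ≤ k}.Finite :=
      (Set.finite_Iic k).preimage PNat.coe_injective.injOn
    have hmaps : Set.MapsTo (appearance x) {i : ℕ+ | (i : ℕ) ≤ k} {i : ℕ+ | (i : ℕ) ≤ k} := by
      intro i hi
      by_contra hgt
      -- all `k` boxes are among the fewer than `k` values listed before position `i`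
      have hTi : T ≤ Nat.nth p i.natPred := by
        by_contra! hlt'
        exact hgt (hlt _ hlt')
      have hval : ∀ a : Fin k, ∃ s < i.natPred, x (Nat.nth p s) = (a : ℕ).succPNat := by
        intro a
        obtain ⟨l, hl, hla⟩ := h (a : ℕ).succPNat a.2
        obtain ⟨j, hjl, hj, hfirst⟩ := exists_first_occurrence (x := x) l
        refine ⟨Nat.count p j, ?_, ?_⟩
        · rw [← hmono.lt_iff_lt, Nat.nth_count (p := p) hfirst]
          exact lt_of_le_of_lt hjl (hl.trans_le hTi)
        · rw [Nat.nth_count (p := p) hfirst, hj, hla]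
      choose s hs hsx using hval
      have hsinj : Function.Injective fun a => (⟨s a, hs a⟩ : Fin i.natPred) := by
        intro a b hab
        have h1 : s a = s b := congrArg Fin.val hab
        have h2 := hsx a
        rw [h1, hsx b] at h2
        exact Fin.ext (Nat.succPNat_injective h2).symm
      have hcard := Fintype.card_le_of_injective _ hsinj
      have := PNat.natPred_add_one i
      simp only [Fintype.card_fin, Set.mem_ofPred_eq] at hcard hi
      omega
    exact (hfin.injOn_iff_bijOn_of_mapsTo hmaps).1 hinj.injOn

end Appearance

section OutsideCount

variable {Ω : Type*} {X : ℕ → Ω → ℕ+}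

theorem outsideCount_succ_lt_iff (n k : ℕ) (ω : Ω) :
    outsideCount X n (k + 1) ω < outsideCount X n k ω ↔ ∃ l < n, (X l ω : ℕ) = k + 1 := by
  have hle : ∀ l ∈ Finset.range n, (if k + 1 < (X l ω : ℕ) then 1 else 0) ≤
      if k < (X l ω : ℕ) then 1 else 0 := by
    intro l _
    split_ifs <;> omega
  unfold outsideCount
  constructor
  · contrapose!
    intro h
    refine (Finset.sum_congr rfl fun l hl => ?_).le
    have := h l (Finset.mem_range.1 hl)
    split_ifs <;> omega
  · rintro ⟨l, hl, hlk⟩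
    exact Finset.sum_lt_sum hle ⟨l, Finset.mem_range.2 hl, by simp [hlk]⟩

theorem isInitialBlock_iff_reversedCounts {ω : Ω}
    (hω : ∀ k : ℕ, ∃ n, outsideCount X n k ω = 1) (k : ℕ) :
    IsInitialBlock (appearance fun i => X i ω) k ↔
      ∀ j : Fin k, reversedCounts X k 1 ω j.castSucc < reversedCounts X k 1 ω j.succ := by
  classical
  have hx : ∀ k : ℕ, ∃ j, k < (X j ω : ℕ) := by
    intro k
    by_contra! hle
    obtain ⟨n, hn⟩ := hω k
    rw [outsideCount, Finset.sum_eq_zero fun i _ => if_neg (not_lt.2 (hle i))] at hn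
    exact zero_ne_one hn
  have hT := Nat.find_spec (hx k)
  have hlt : ∀ l < Nat.find (hx k), (X l ω : ℕ) ≤ k := fun l hl => not_lt.1 (Nat.find_min (hx k) hl)
  set T := Nat.find (hx k)
  have hcount : outsideCount X (T + 1) k ω = 1 := by
    rw [outsideCount_succ, if_pos hT, outsideCount, Finset.sum_eq_zero]
    intro l hl
    exact if_neg (not_lt.2 (hlt l (Finset.mem_range.1 hl)))
  rw [isInitialBlock_appearance_iff hx hT hlt]
  simp only [reversedCounts, hitTime_eq hT hcount, Fin.val_castSucc, Fin.val_succ]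
  have hstep : ∀ j : ℕ, j < k → (outsideCount X (T + 1) (k - j) ω <
      outsideCount X (T + 1) (k - (j + 1)) ω ↔ ∃ l < T, (X l ω : ℕ) = k - j) := by
    intro j hj
    obtain ⟨i, hi⟩ : ∃ i, k - j = i + 1 := ⟨k - j - 1, by omega⟩
    rw [show k - (j + 1) = i by omega, hi, outsideCount_succ_lt_iff]
    constructor
    · rintro ⟨l, hl, hli⟩
      refine ⟨l, lt_of_le_of_ne (Nat.lt_succ_iff.1 hl) ?_, hli⟩
      rintro rfl
      omega
    · rintro ⟨l, hl, hli⟩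
      exact ⟨l, by omega, hli⟩
  constructor
  · intro h j
    obtain ⟨l, hl, hli⟩ := h ⟨k - j, by omega⟩ (Nat.sub_le k j)
    exact (hstep j j.2).2 ⟨l, hl, congrArg PNat.val hli⟩
  · intro h i hi
    have hi0 := i.pos
    obtain ⟨l, hl, hli⟩ := (hstep (k - i) (by omega)).1 (h ⟨k - i, by omega⟩)
    exact ⟨l, hl, PNat.coe_injective (by rw [hli]; omega)⟩

end OutsideCount

/-! ### Renewal probabilities -/

section Renewal

variable {Ω : Type*} [MeasurableSpace Ω] {μ : Measure Ω} [IsProbabilityMeasure μ]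
  {ν : Measure unitInterval} {W : ℕ+ → Ω → unitInterval} {X : ℕ → Ω → ℕ+}
  {Ω' : Type*} [MeasurableSpace Ω'] {μ' : Measure Ω'} [IsProbabilityMeasure μ'] {Q : ℕ → Ω' → ℕ+}

theorem renewalProb_eq (hW : IsStickBreaking ν W μ) (hX : IsSampleFrom (ramWeight W) X μ)
    (hQ : IsMarkovChain (qHat ν) Q μ') (hm : μ' {ω | Q 0 ω = 1} ≠ 0) (k : ℕ) :
    renewalProb μ X k = (μ'[|{ω | Q 0 ω = 1}]).real {ω | ∀ j < k, Q j ω < Q (j + 1) ω} := by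
  have hid := identDistrib_reversedCounts hW hX hQ k 1 hm
  have hS := hid.measure_mem_eq
    (s := {y : Fin (k + 1) → ℕ | ∀ j : Fin k, y j.castSucc < y j.succ}) .of_discrete
  have hae : ∀ᵐ ω ∂μ, ∀ k : ℕ, ∃ n, outsideCount X n k ω = 1 :=
    ae_all_iff.2 fun k => ae_exists_outsideCount_eq hW hX k 1
  rw [renewalProb, measureReal_def, measureReal_def]
  congr 1
  trans μ (reversedCounts X k ((1 : ℕ+) : ℕ) ⁻¹'
      {y : Fin (k + 1) → ℕ | ∀ j : Fin k, y j.castSucc < y j.succ})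
  · refine measure_congr ?_
    filter_upwards [hae] with ω hω
    exact propext (isInitialBlock_iff_reversedCounts hω k)
  · rw [hS]
    congr 1
    ext ω
    simp [Fin.forall_iff]

theorem measurableSet_strictlyIncreasing (hQ : ∀ j, Measurable (Q j)) (k : ℕ) :
    MeasurableSet {ω | ∀ j < k, Q j ω < Q (j + 1) ω} := by
  simp only [Set.ofPred_forall]
  refine .iInter fun j => .iInter fun _ => ?_
  have h : MeasurableSet {p : ℕ+ × ℕ+ | p.1 < p.2} := .of_discrete
  exact ((hQ j).prodMk (hQ (j + 1))) h

theorem renewalProb_succ_lt (hW : IsStickBreaking ν W μ) (hX : IsSampleFrom (ramWeight W) X μ)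
    (k : ℕ) : renewalProb μ X (k + 1) < renewalProb μ X k := by
  have := hW.isProbabilityMeasure
  obtain ⟨κ, hκ, hQ, hm⟩ := exists_isMarkovChain_qHat hW 1
  rw [renewalProb_eq hW hX hQ hm, renewalProb_eq hW hX hQ hm]
  have hprob : IsProbabilityMeasure (κ[|{x | x 0 = 1}]) := cond_isProbabilityMeasure hm
  -- the path `1, 2, …, k + 1, k + 1`, which is strictly increasing for exactly `k` steps
  let z : ℕ → ℕ+ := fun i => if i ≤ k then i.succPNat else k.succPNat
  have hz : z 0 = 1 := rfl
  have hpos : 0 < (κ[|{x | x 0 = 1}]) {x | ∀ i ≤ k + 1, x i = z i} := by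
    rw [hQ.cond_path hm (k + 1) hz, pos_iff_ne_zero, Finset.prod_ne_zero_iff]
    intro i hi
    rw [← pos_iff_ne_zero, ENNReal.ofReal_pos]
    refine qHat_pos hW.mem_Ioo ?_
    have := Finset.mem_range.1 hi
    simp only [z]
    split_ifs
    · exact Nat.succPNat_mono (Nat.le_succ i)
    · exact Nat.succPNat_mono (by omega)
    · exact absurd this (by omega)
    · exact le_rfl
  have hmeas := measurableSet_strictlyIncreasing hQ.measurable
  rw [measureReal_def, measureReal_def,
    ENNReal.toReal_lt_toReal (measure_ne_top _ _) (measure_ne_top _ _)]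
  have hdisj : Disjoint {x : ℕ → ℕ+ | ∀ i ≤ k + 1, x i = z i}
      {x | ∀ j < k + 1, x j < x (j + 1)} := by
    refine Set.disjoint_left.2 fun x h1 h2 => ?_
    have h3 := h2 k (Nat.lt_succ_self k)
    rw [h1 k (Nat.le_succ k), h1 (k + 1) le_rfl] at h3
    simp [z] at h3
  calc (κ[|{x | x 0 = 1}]) {x | ∀ j < k + 1, x j < x (j + 1)}
      < (κ[|{x | x 0 = 1}]) {x | ∀ i ≤ k + 1, x i = z i} +
          (κ[|{x | x 0 = 1}]) {x | ∀ j < k + 1, x j < x (j + 1)} :=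
        (ENNReal.lt_add_right (measure_ne_top _ _) hpos.ne').trans_eq (add_comm _ _)
    _ = (κ[|{x | x 0 = 1}]) ({x | ∀ i ≤ k + 1, x i = z i} ∪
          {x | ∀ j < k + 1, x j < x (j + 1)}) := (measure_union hdisj (hmeas (k + 1))).symm
    _ ≤ (κ[|{x | x 0 = 1}]) {x | ∀ j < k, x j < x (j + 1)} := by
        refine measure_mono (Set.union_subset (fun x hx j hj => ?_)
          fun x hx j hj => hx j (hj.trans (Nat.lt_succ_self k)))
        rw [hx j (by omega), hx (j + 1) (by omega)]
        simp only [z]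
        rw [if_pos (by omega), if_pos (by omega)]
        exact Nat.succPNat_strictMono (Nat.lt_succ_self j)

theorem tendsto_renewalProb (hW : IsStickBreaking ν W μ) (hX : IsSampleFrom (ramWeight W) X μ)
    (hQ : IsMarkovChain (qHat ν) Q μ') (hm : μ' {ω | Q 0 ω = 1} ≠ 0) :
    Tendsto (fun k => renewalProb μ X k) atTop
      (𝓝 ((μ'[|{ω | Q 0 ω = 1}]).real {ω | ∀ j, Q j ω < Q (j + 1) ω})) := by
  simp_rw [renewalProb_eq hW hX hQ hm]
  have hprob : IsProbabilityMeasure (μ'[|{ω | Q 0 ω = 1}]) := cond_isProbabilityMeasure hm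
  have hset : {ω | ∀ j, Q j ω < Q (j + 1) ω} = ⋂ k, {ω | ∀ j < k, Q j ω < Q (j + 1) ω} := by
    ext ω
    simp only [Set.mem_ofPred_eq, Set.mem_iInter]
    exact ⟨fun h k j _ => h j, fun h j => h (j + 1) j (Nat.lt_succ_self j)⟩
  rw [hset]
  refine (ENNReal.tendsto_toReal (measure_ne_top _ _)).comp (tendsto_measure_iInter_atTop
    (fun k => (measurableSet_strictlyIncreasing hQ.measurable k).nullMeasurableSet)
    (fun k l hkl ω hω j hj => hω j (hj.trans_le hkl)) ⟨0, measure_ne_top _ _⟩)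

theorem cond_increment (hW : IsStickBreaking ν W μ) (hQ : IsMarkovChain (qHat ν) Q μ') (j : ℕ)
    (m : ℕ+) (hm : μ' {ω | Q j ω = m} ≠ 0) (d : ℕ) :
    (μ'[|{ω | Q j ω = m}]) {ω | (Q (j + 1) ω : ℕ) = (Q j ω : ℕ) + d} =
      ∫⁻ w, negBinomial m (unitInterval.symm w) {d} ∂ν := by
  have := hW.isProbabilityMeasure
  let n : ℕ+ := ⟨m + d, by have := m.pos; omega⟩
  have hn : (n : ℕ) = m + d := rfl
  trans (μ'[|{ω | Q j ω = m}]) {ω | Q (j + 1) ω = n}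
  · refine measure_congr ?_
    filter_upwards [ae_cond_mem (hQ.measurableSet_eq j m)] with ω hω
    refine propext ?_
    change (Q (j + 1) ω : ℕ) = (Q j ω : ℕ) + d ↔ Q (j + 1) ω = n
    rw [show Q j ω = m from hω, ← hn, PNat.coe_inj]
  · rw [hQ.cond_step hm, ofReal_qHat_eq_lintegral_pascal hW.mem_Ioo, hn]
    simp_rw [pascal_apply_add]

end Renewal

end ResidualAllocation

theorem mainTheorem10 {Ω : Type*} [MeasurableSpace Ω] (μ : Measure Ω) [IsProbabilityMeasure μ]
    (ν : Measure unitInterval) (W : ℕ+ → Ω → unitInterval) (X : ℕ → Ω → ℕ+)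
    (hW : IsStickBreaking ν W μ) (hX : IsSampleFrom (ramWeight W) X μ) :
    -- the times `n(k,m)` are almost surely well defined
    (∀ (k : ℕ) (m : ℕ+), ∀ᵐ ω ∂μ, ∃ n, outsideCount X n k ω = m) ∧
    -- `qHat ν` is a transition probability function, and chains with any initial law exist
    (∀ m n : ℕ+, 0 ≤ qHat ν m n) ∧
    (∀ m : ℕ+, HasSum (fun n => qHat ν m n) 1) ∧
    (∀ π : Measure ℕ+, IsProbabilityMeasure π → ∃ κ : Measure (ℕ → ℕ+),
      IsProbabilityMeasure κ ∧ IsMarkovChain (qHat ν) (fun j x => x j) κ ∧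
        κ.map (fun x => x 0) = π) ∧
    -- `qHat ν m` is the mixture of Pascal `(m, 1 - W)` distributions
    (∀ m n : ℕ+, ENNReal.ofReal (qHat ν m n) =
      ∫⁻ w, pascal m (unitInterval.symm w) {(n : ℕ)} ∂ν) ∧
    -- the sequence of renewal probabilities is strictly decreasing
    (∀ k : ℕ, 1 ≤ k → renewalProb μ X (k + 1) < renewalProb μ X k) ∧
    -- for every Markov chain `Q` with transition function `qHat ν`:
    (∀ {Ω' : Type*} [MeasurableSpace Ω'] (μ' : Measure Ω') [IsProbabilityMeasure μ']
      (Q : ℕ → Ω' → ℕ+), IsMarkovChain (qHat ν) Q μ' →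
      -- its paths are almost surely weakly increasing
      (∀ᵐ ω ∂μ', Monotone fun j => Q j ω) ∧
      -- its increments from state `m` are mixed negative binomial `(m, 1 - W)`
      (∀ (j : ℕ) (m : ℕ+), μ' {ω | Q j ω = m} ≠ 0 → ∀ d : ℕ,
        (μ'[|{ω | Q j ω = m}]) {ω | (Q (j + 1) ω : ℕ) = (Q j ω : ℕ) + d} =
          ∫⁻ w, negBinomial m (unitInterval.symm w) {d} ∂ν) ∧
      -- given `Q 0 = m`, it has the joint law of the reversed counts
      (∀ (k : ℕ) (m : ℕ+), μ' {ω | Q 0 ω = m} ≠ 0 →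
        IdentDistrib
          (fun ω (j : Fin (k + 1)) => outsideCount X (hitTime X k m ω) (k - (j : ℕ)) ω)
          (fun ω (j : Fin (k + 1)) => (Q (j : ℕ) ω : ℕ))
          μ (μ'[|{ω | Q 0 ω = m}])) ∧
      -- started at `1`, it is strictly increasing for `k` steps with probability `u k`,
      -- and forever with probability `lim u k`
      (μ' {ω | Q 0 ω = 1} ≠ 0 →
        (∀ k : ℕ, 1 ≤ k → renewalProb μ X k =
          (μ'[|{ω | Q 0 ω = 1}]).real {ω | ∀ j < k, Q j ω < Q (j + 1) ω}) ∧
        Tendsto (fun k => renewalProb μ X k) atTop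
          (𝓝 ((μ'[|{ω | Q 0 ω = 1}]).real {ω | ∀ j, Q j ω < Q (j + 1) ω})))) := by
  have hprob := hW.isProbabilityMeasure
  refine ⟨ae_exists_outsideCount_eq hW hX, qHat_nonneg, hasSum_qHat hW.mem_Ioo,
    fun π hπ => exists_isMarkovChain qHat_nonneg (hasSum_qHat hW.mem_Ioo) π,
    ofReal_qHat_eq_lintegral_pascal hW.mem_Ioo, fun k _ => renewalProb_succ_lt hW hX k, ?_⟩
  intro Ω' _ μ' _ Q hQ
  exact ⟨hQ.ae_monotone fun _ _ => qHat_of_lt, cond_increment hW hQ,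
    identDistrib_reversedCounts hW hX hQ,
    fun hm => ⟨fun k _ => renewalProb_eq hW hX hQ hm k, tendsto_renewalProb hW hX hQ hm⟩⟩
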